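/- Let $m_0,m_1,m_2,\dots$ be i.i.d. real random variables (the carrier-frequency offsets) whose common law is symmetric about $0$ (for instance, has an even density or an even probability mass function), and let $\Phi(x)=\mathbb E\,e^{j2\pi m_0x}$, which is then real. Let $\delta\neq0$ and $q,p\in\mathbb R$, and put $\alpha=2\pi p/\delta$. For $N\ge1$ consider the beampattern of the $N$-element random frequency diverse array (RFDA), $$\beta_N(q,p)=\frac1N e^{j2\pi p/\delta}\sum_{n=0}^{N-1}e^{j2\pi\left(n-\frac{N-1}{2}\right)q}\,e^{j2\pi m_np},$$ and let $\boldsymbol\beta_N=[\operatorname{Re}\beta_N(q,p),\ \operatorname{Im}\beta_N(q,p)]^T$. Let $S_a^N(x)=\sin(N\pi x)/\sin(\pi x)$, extended by continuity to the integers $x$. Then, for every $N\ge1$, the mean of $\boldsymbol\beta_N$ is $$\mu_N=\frac1N S_a^N(q)\,\Phi(p)\begin{bmatrix}\cos\alpha\\ \sin\alpha\end{bmatrix}$$ and its covariance matrix is $$\mathbf M_N=\begin{bmatrix}\sigma_r^2\cos^2\alpha+\sigma_i^2\sin^2\alpha&(\sigma_r^2-\sigma_i^2)\sin\alpha\cos\alpha\\(\sigma_r^2-\sigma_i^2)\sin\alpha\cos\alpha&\sigma_r^2\sin^2\alpha+\sigma_i^2\cos^2\alpha\end{bmatrix},$$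 where $$\sigma_r^2=\frac1{2N}\Big[1-\Phi^2(p)-\frac{S_a^N(2q)}{N}\big(\Phi^2(p)-\Phi(2p)\big)\Big],\qquad \sigma_i^2=\frac1{2N}\Big[1-\Phi^2(p)+\frac{S_a^N(2q)}{N}\big(\Phi^2(p)-\Phi(2p)\big)\Big].$$ Moreover, $\boldsymbol\beta_N$ is asymptotically jointly Gaussian with mean $\mu_N$ and covariance $\mathbf M_N$ as $N\to\infty$, in the following sense. For every bounded continuous $f:\mathbb R^2\to\mathbb R$, $$\mathbb E f\big(\sqrt N(\boldsymbol\beta_N-\mu_N)\big)-\int f\,d\mathcal N(0,N\mathbf M_N)\longrightarrow0 ;$$ and for every sequence of real $2\times2$ matrices $A_N$ with $A_N\mathbf M_NA_N^T=I$ for all large $N$, the vectors $A_N(\boldsymbol\beta_N-\mu_N)$ converge in distribution to $\mathcal N(0,I)$. -/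

import Mathlib

open MeasureTheory ProbabilityTheory Filter Topology
open scoped BoundedContinuousFunction

noncomputable section

namespace RFDA

/-- The (far-field, narrow-band) steering vector of an `N`-element random frequency diverse array
with centre frequency `fc`, frequency increment `Δf`, element spacing `d`, wave speed `c` and
frequency offsets `m n`, for a target with direction `θ` and range `r`. -/
def steeringVector (N : ℕ) (fc Δf d c : ℝ) (m : ℕ → ℝ) (θ r : ℝ) : EuclideanSpace ℂ (Fin N) :=
  WithLp.toLp 2 fun n : Fin N =>
    Complex.exp (((-(4 * Real.pi / c * (fc * r
      + ((n : ℝ) - ((N : ℝ) - 1) / 2) * fc * d * Real.sin θ + m n * Δf * r)) : ℝ) : ℂ) *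
        Complex.I)

/-- The beampattern `β(q, p) = (1/N) e^{j 2π p/δ} ∑_{n<N} e^{j 2π (n-(N-1)/2) q} e^{j 2π m_n p}` of
an `N`-element array with frequency offsets `m n` and relative frequency increment `δ`. -/
def beampattern (N : ℕ) (δ q p : ℝ) (m : ℕ → ℝ) : ℂ :=
  (1 / (N : ℂ)) * Complex.exp (((2 * Real.pi * (p / δ) : ℝ) : ℂ) * Complex.I) *
    ∑ n ∈ Finset.range N,
      Complex.exp (((2 * Real.pi * ((n : ℝ) - ((N : ℝ) - 1) / 2) * q : ℝ) : ℂ) * Complex.I) *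
        Complex.exp (((2 * Real.pi * m n * p : ℝ) : ℂ) * Complex.I)

/-- `β(q, p)` is the normalized response of the array beamformed to `(θ₂, r₂)` to a target at
`(θ₁, r₁)`, where `q = 2 (sin θ₁ - sin θ₂) fc d / c`, `p = 2 (r₁ - r₂) Δf / c`, `δ = Δf / fc`. -/
theorem beampattern_eq_response (N : ℕ) (fc Δf d c : ℝ) (hΔf : Δf ≠ 0)
    (m : ℕ → ℝ) (θ₁ r₁ θ₂ r₂ : ℝ) :
    beampattern N (Δf / fc) (2 * (Real.sin θ₁ - Real.sin θ₂) * fc * d / c)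
        (2 * (r₁ - r₂) * Δf / c) m =
      inner ℂ (steeringVector N fc Δf d c m θ₁ r₁) (steeringVector N fc Δf d c m θ₂ r₂) /
        ((‖steeringVector N fc Δf d c m θ₁ r₁‖ : ℂ) *
          (‖steeringVector N fc Δf d c m θ₂ r₂‖ : ℂ)) := by
  have hn : ∀ θ r, ‖steeringVector N fc Δf d c m θ r‖ = Real.sqrt N := by
    intro θ r
    rw [EuclideanSpace.norm_eq]
    congr 1
    simp only [steeringVector, Complex.norm_exp_ofReal_mul_I]
    simp
  have hs : ((Real.sqrt N : ℝ) : ℂ) * ((Real.sqrt N : ℝ) : ℂ) = (N : ℂ) := by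
    rw [← Complex.ofReal_mul, Real.mul_self_sqrt (Nat.cast_nonneg N), Complex.ofReal_natCast]
  rw [hn, hn, hs, PiLp.inner_apply, beampattern, Finset.sum_range, mul_assoc, Finset.mul_sum,
    one_div, inv_mul_eq_div]
  congr 1
  refine Finset.sum_congr rfl fun n _ => ?_
  simp only [steeringVector, RCLike.inner_apply, ← Complex.exp_conj, map_mul, Complex.conj_I,
    Complex.conj_ofReal, ← Complex.exp_add]
  congr 1
  have h : ∀ a b e f g : ℝ, a + (b + e) = f - g →
      (a : ℂ) * Complex.I + ((b : ℂ) * Complex.I + (e : ℂ) * Complex.I) =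
        (f : ℂ) * Complex.I + (g : ℂ) * -Complex.I := by
    intro a b e f g h
    have h' : (a : ℂ) + (b + e) = f - g := by exact_mod_cast h
    linear_combination Complex.I * h'
  apply h
  by_cases hfc : fc = 0
  · subst hfc; simp; ring
  by_cases hc : c = 0
  · subst hc; simp
  field_simp
  ring

/-- The real random vector `(β₁, β₂) = (Re β(q, p), Im β(q, p))`. -/
def beamVector {Ω : Type*} (N : ℕ) (δ q p : ℝ) (m : ℕ → Ω → ℝ) (ω : Ω) :
    EuclideanSpace ℝ (Fin 2) :=
  !₂[(beampattern N δ q p fun n => m n ω).re, (beampattern N δ q p fun n => m n ω).im]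

/-- The function `S_a^N(x) = sin (N π x) / sin (π x)`, extended by continuity to the integers,
where it takes the value `N cos ((N - 1) π x) = ± N`. -/
def sincRatio (N : ℕ) (x : ℝ) : ℝ :=
  if Real.sin (Real.pi * x) = 0 then (N : ℝ) * Real.cos (((N : ℝ) - 1) * Real.pi * x)
  else Real.sin ((N : ℝ) * Real.pi * x) / Real.sin (Real.pi * x)

/-- `Φ(x) = 𝔼 e^{j 2π m x}` for `m` with law `ν`. -/
def genFun (ν : Measure ℝ) (x : ℝ) : ℂ :=
  ∫ t, Complex.exp (((2 * Real.pi * t * x : ℝ) : ℂ) * Complex.I) ∂ν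

/-- The variance `σ_r²`. (For a symmetric law `Φ` is real, so `Φ` is its own real part.) -/
def sigmaRSq (ν : Measure ℝ) (N : ℕ) (q p : ℝ) : ℝ :=
  1 / (2 * (N : ℝ)) * (1 - (genFun ν p).re ^ 2
    - sincRatio N (2 * q) / N * ((genFun ν p).re ^ 2 - (genFun ν (2 * p)).re))

/-- The variance `σ_i²`. -/
def sigmaISq (ν : Measure ℝ) (N : ℕ) (q p : ℝ) : ℝ :=
  1 / (2 * (N : ℝ)) * (1 - (genFun ν p).re ^ 2
    + sincRatio N (2 * q) / N * ((genFun ν p).re ^ 2 - (genFun ν (2 * p)).re))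

/-- The mean vector `(1/N) S_a^N(q) Φ(p) (cos α, sin α)` with `α = 2π p / δ`. -/
def meanVector (ν : Measure ℝ) (N : ℕ) (δ q p : ℝ) : EuclideanSpace ℝ (Fin 2) :=
  (1 / (N : ℝ) * sincRatio N q * (genFun ν p).re) •
    !₂[Real.cos (2 * Real.pi * p / δ), Real.sin (2 * Real.pi * p / δ)]

/-- `diag (σ_r², σ_i²)` rotated by the angle `α = 2π p / δ`. -/
def covFormula (ν : Measure ℝ) (N : ℕ) (δ q p : ℝ) : Matrix (Fin 2) (Fin 2) ℝ :=
  let α := 2 * Real.pi * p / δ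
  let vr := sigmaRSq ν N q p
  let vi := sigmaISq ν N q p
  !![vr * Real.cos α ^ 2 + vi * Real.sin α ^ 2, (vr - vi) * Real.sin α * Real.cos α;
     (vr - vi) * Real.sin α * Real.cos α, vr * Real.sin α ^ 2 + vi * Real.cos α ^ 2]

/-- The covariance matrix `𝔼 [(X - 𝔼 X) (X - 𝔼 X)ᵀ]` of a random vector in the plane. -/
def covMatrix {Ω : Type*} [MeasurableSpace Ω] (P : Measure Ω)
    (X : Ω → EuclideanSpace ℝ (Fin 2)) : Matrix (Fin 2) (Fin 2) ℝ :=
  Matrix.of fun i j => covariance (fun ω => X ω i) (fun ω => X ω j) P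

/-- Random vectors `X N` in the plane are asymptotically jointly Gaussian (at scale `1 / √N`) with
means `μ N` and covariance matrices `M N`:
* the laws of `√N (X N - μ N)` and the Gaussian laws `𝒩(0, N • M N)` are asymptotically equal in
  the topology of convergence in distribution (no convergence of `N • M N` is needed for this, and
  degenerate covariance matrices are allowed), and
* for every sequence of matrices `A N` which standardizes the covariances, the vectors
  `A N (X N - μ N)` converge in distribution to the standard Gaussian law of the plane. -/
structure AsymptoticallyGaussian {Ω : Type*} [MeasurableSpace Ω] (P : Measure Ω)
    [IsProbabilityMeasure P] (X : ℕ → Ω → EuclideanSpace ℝ (Fin 2))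
    (μ : ℕ → EuclideanSpace ℝ (Fin 2)) (M : ℕ → Matrix (Fin 2) (Fin 2) ℝ) : Prop where
  tendsto_integral_sub : ∀ f : EuclideanSpace ℝ (Fin 2) →ᵇ ℝ,
    Tendsto (fun N : ℕ => (∫ ω, f (Real.sqrt N • (X N ω - μ N)) ∂P)
      - ∫ x, f x ∂(multivariateGaussian 0 ((N : ℝ) • M N))) atTop (𝓝 0)
  tendsto_standardized : ∀ A : ℕ → Matrix (Fin 2) (Fin 2) ℝ,
    (∀ᶠ N in atTop, A N * M N * (A N).transpose = 1) →
      TendstoInDistribution (fun N ω => Matrix.toEuclideanLin (A N) (X N ω - μ N)) atTop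
        id (fun _ => P) (stdGaussian (EuclideanSpace ℝ (Fin 2)))

end RFDA

end

/-! Everything reduces to scalar projections. For `s` in the plane, the inner product of the
beampattern vector with `s` is a sum of independent terms `Re (c_n e^{j 2π m_n p})` with `|c_n| =
‖s‖ / N`. Symmetry makes `Φ` real, so the means involve `Re c_n`. The identity `(Re z)² = (|z|² + Re
z²) / 2` expresses the variances through `|c_n|²` and `Re c_n²`. Summing the geometric progressions
gives `S_a^N(q)` and `S_a^N(2q)`, and polarization recovers the covariance matrix.

For the Gaussian limit, the centred summands of the projection of `√N (β_N - μ_N)` are bounded by `K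
= 2‖s‖ / √N`. Each characteristic function is within `K³` of `exp (-Var / 2)`. Comparing products
costs at most `N K³ = O(‖s‖³ / √N)`, uniformly for bounded `s` (`norm_charFun_sub_exp_le`).

The matrices `N M_N` need not converge, but their eigenvalues stay in a compact interval. Along a
subsequence both the normalized laws and the Gaussian laws tend to the same, possibly degenerate,
Gaussian. When `A_N` standardizes `M_N`, the eigenvalues of `N M_N` are also bounded below, so `A_Nᵀ
t / √N` stays bounded and the uniform estimate applies at these moving points. -/

namespace RFDA

open scoped Matrix

/-! ### Moments of a single random phase -/

/-- The random phase `e^{j 2π t p}` produced by a frequency offset `t`. -/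
noncomputable def phase (p t : ℝ) : ℂ := Complex.exp (((2 * Real.pi * t * p : ℝ) : ℂ) * Complex.I)

lemma continuous_phase (p : ℝ) : Continuous (phase p) := by
  unfold phase; fun_prop

@[fun_prop]
lemma measurable_phase (p : ℝ) : Measurable (phase p) := (continuous_phase p).measurable

lemma norm_phase (p t : ℝ) : ‖phase p t‖ = 1 := by
  unfold phase; exact Complex.norm_exp_ofReal_mul_I _

lemma phase_sq (p t : ℝ) : phase p t ^ 2 = phase (2 * p) t := by
  unfold phase
  rw [← Complex.exp_nat_mul]
  congr 1
  push_cast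
  ring

lemma integrable_phase (ν : Measure ℝ) [IsProbabilityMeasure ν] (p : ℝ) :
    Integrable (phase p) ν :=
  Integrable.of_bound (by fun_prop) 1 (ae_of_all _ fun t => (norm_phase p t).le)

lemma integral_phase (ν : Measure ℝ) (p : ℝ) : ∫ t, phase p t ∂ν = genFun ν p := rfl

/-- The characteristic function of a symmetric law is real. -/
lemma genFun_eq_re {ν : Measure ℝ} (hν : ν.map (fun x => -x) = ν) (x : ℝ) :
    (((genFun ν x).re : ℝ) : ℂ) = genFun ν x := by
  rw [← Complex.conj_eq_iff_re, ← integral_phase]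
  conv_rhs => rw [← hν]
  rw [integral_map (by fun_prop) (by fun_prop), ← integral_conj]
  congr with t
  simp only [phase, ← Complex.exp_conj, map_mul, Complex.conj_I, Complex.conj_ofReal]
  congr 1
  push_cast
  ring

lemma abs_re_mul_phase_le (c : ℂ) (p t : ℝ) : |(c * phase p t).re| ≤ ‖c‖ := by
  simpa [norm_phase] using Complex.abs_re_le_norm (c * phase p t)

/-- Symmetry enters here: `Φ(p)` has no imaginary part for `c.im` to multiply. -/
lemma integral_re_mul_phase {ν : Measure ℝ} [IsProbabilityMeasure ν]
    (hν : ν.map (fun x => -x) = ν) (c : ℂ) (p : ℝ) :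
    ∫ t, (c * phase p t).re ∂ν = c.re * (genFun ν p).re := by
  have h := integral_re ((integrable_phase ν p).const_mul c)
  simp only [RCLike.re_eq_complex_re] at h
  rw [h, integral_const_mul, integral_phase, ← genFun_eq_re hν]
  simp

lemma memLp_re_mul_phase (ν : Measure ℝ) [IsProbabilityMeasure ν] (c : ℂ) (p : ℝ) :
    MemLp (fun t => (c * phase p t).re) 2 ν :=
  MemLp.of_bound (by fun_prop) ‖c‖ (ae_of_all _ fun t => abs_re_mul_phase_le c p t)

/-- Source of the doubled arguments `2p` and `2q`: for a phase the modulus is deterministic, while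
squaring doubles the frequency. -/
lemma re_sq_eq (z : ℂ) : z.re ^ 2 = 1 / 2 * ‖z‖ ^ 2 + 1 / 2 * (z ^ 2).re := by
  rw [← Complex.normSq_eq_norm_sq, Complex.normSq_apply, pow_two z, Complex.mul_re]
  ring

lemma variance_re_mul_phase {ν : Measure ℝ} [IsProbabilityMeasure ν]
    (hν : ν.map (fun x => -x) = ν) (c : ℂ) (p : ℝ) :
    Var[fun t => (c * phase p t).re; ν] = 1 / 2 * ‖c‖ ^ 2 * (1 - (genFun ν p).re ^ 2)
      - 1 / 2 * (c ^ 2).re * ((genFun ν p).re ^ 2 - (genFun ν (2 * p)).re) := by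
  rw [variance_eq_sub (memLp_re_mul_phase ν c p), integral_re_mul_phase hν]
  have h : ∀ t, ((fun t => (c * phase p t).re) ^ 2) t =
      1 / 2 * ‖c‖ ^ 2 + 1 / 2 * (c ^ 2 * phase (2 * p) t).re := fun t => by
    simp only [Pi.pow_apply]
    rw [re_sq_eq, mul_pow, phase_sq, norm_mul, norm_phase, mul_one]
  simp_rw [h]
  rw [integral_add (integrable_const _)
      (((memLp_re_mul_phase ν (c ^ 2) (2 * p)).integrable one_le_two).const_mul _),
    integral_const, integral_const_mul, integral_re_mul_phase hν]
  simp only [probReal_univ, one_smul, mul_pow, re_sq_eq c]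
  ring

/-! ### The centred geometric sum -/

/-- The centred exponential sum `∑ e^{j 2π (n - (N - 1)/2) x}` is the ratio
`sin (N π x) / sin (π x)`. -/
lemma sum_exp_eq_sincRatio (N : ℕ) (x : ℝ) :
    ∑ n ∈ Finset.range N,
      Complex.exp (((2 * Real.pi * ((n : ℝ) - ((N : ℝ) - 1) / 2) * x : ℝ) : ℂ) * Complex.I) =
      (sincRatio N x : ℂ) := by
  unfold sincRatio
  split_ifs with h
  · obtain ⟨k, hk⟩ := Real.sin_eq_zero_iff.1 h
    have hx : x = k := mul_left_cancel₀ Real.pi_ne_zero (by rw [← hk]; ring)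
    subst hx
    have hterm : ∀ n ∈ Finset.range N, Complex.exp (((2 * Real.pi *
        ((n : ℝ) - ((N : ℝ) - 1) / 2) * k : ℝ) : ℂ) * Complex.I) =
        ((Real.cos (((N : ℝ) - 1) * Real.pi * k) : ℝ) : ℂ) := by
      intro n _
      have hs : Real.sin (((N : ℝ) - 1) * Real.pi * k) = 0 :=
        Real.sin_eq_zero_iff.2 ⟨((N : ℤ) - 1) * k, by push_cast; ring⟩
      -- At an integer `k` the angle depends on `n` only through a multiple of `2π`, so all terms
      -- coincide.
      have hneg : ((2 * Real.pi * ((n : ℝ) - ((N : ℝ) - 1) / 2) * k : ℝ)) =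
          -(((N : ℝ) - 1) * Real.pi * k) + ((n * k : ℤ) : ℝ) * (2 * Real.pi) := by
        push_cast; ring
      rw [hneg, Complex.exp_mul_I, ← Complex.ofReal_cos, ← Complex.ofReal_sin,
        Real.cos_add_int_mul_two_pi, Real.sin_add_int_mul_two_pi, Real.cos_neg, Real.sin_neg, hs]
      simp
    rw [Finset.sum_congr rfl hterm, Finset.sum_const, Finset.card_range, nsmul_eq_mul]
    push_cast
    ring
  · have h' : ((Real.sin (Real.pi * x) : ℝ) : ℂ) ≠ 0 := by exact_mod_cast h
    rw [Complex.ofReal_div, eq_div_iff h', Finset.sum_mul]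
    -- Multiplication by `sin (π x)`, written with exponentials, makes the sum telescope.
    have hterm : ∀ n ∈ Finset.range N, Complex.exp (((2 * Real.pi *
        ((n : ℝ) - ((N : ℝ) - 1) / 2) * x : ℝ) : ℂ) * Complex.I) *
          ((Real.sin (Real.pi * x) : ℝ) : ℂ) =
        (fun n : ℕ => -(Complex.I / 2) *
          Complex.exp (((Real.pi * x * (2 * n - N) : ℝ) : ℂ) * Complex.I)) (n + 1) -
        (fun n : ℕ => -(Complex.I / 2) *
          Complex.exp (((Real.pi * x * (2 * n - N) : ℝ) : ℂ) * Complex.I)) n := by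
      intro n _
      rw [Complex.ofReal_sin, Complex.sin]
      have e1 : Complex.exp (((Real.pi * x * (2 * (n + 1 : ℕ) - N) : ℝ) : ℂ) * Complex.I) =
          Complex.exp (((2 * Real.pi * ((n : ℝ) - ((N : ℝ) - 1) / 2) * x : ℝ) : ℂ) * Complex.I) *
          Complex.exp (((Real.pi * x : ℝ) : ℂ) * Complex.I) := by
        rw [← Complex.exp_add]; congr 1; push_cast; ring
      have e2 : Complex.exp (((Real.pi * x * (2 * n - N) : ℝ) : ℂ) * Complex.I) =
          Complex.exp (((2 * Real.pi * ((n : ℝ) - ((N : ℝ) - 1) / 2) * x : ℝ) : ℂ) * Complex.I) *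
          Complex.exp (-((Real.pi * x : ℝ) : ℂ) * Complex.I) := by
        rw [← Complex.exp_add]; congr 1; push_cast; ring
      simp only [e1, e2]
      ring
    rw [Finset.sum_congr rfl hterm, Finset.sum_range_sub (fun n : ℕ => -(Complex.I / 2) *
      Complex.exp (((Real.pi * x * (2 * n - N) : ℝ) : ℂ) * Complex.I)),
      Complex.ofReal_sin, Complex.sin]
    have e3 : ((Real.pi * x * (2 * N - N) : ℝ) : ℂ) = ((N * Real.pi * x : ℝ) : ℂ) := by
      congr 1; ring
    have e4 : ((Real.pi * x * (2 * (0 : ℕ) - N) : ℝ) : ℂ) = -((N * Real.pi * x : ℝ) : ℂ) := by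
      rw [← Complex.ofReal_neg]; congr 1; push_cast; ring
    rw [e3, e4]
    ring

/-! ### Taylor estimate and comparison of products -/

/-- Second-order expansion of the characteristic function of a small centred random variable. -/
lemma norm_integral_exp_sub_exp_neg_variance_le {α : Type*} [MeasurableSpace α] {μ : Measure α}
    [IsProbabilityMeasure μ] {X : α → ℝ} (hX : AEMeasurable X μ) {K : ℝ} (hK : K ≤ 1)
    (hb : ∀ a, |X a| ≤ K) (h0 : μ[X] = 0) :
    ‖∫ a, Complex.exp (X a * Complex.I) ∂μ - Complex.exp (-((Var[X; μ] : ℝ) : ℂ) / 2)‖ ≤ K ^ 3 := by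
  have hK0 : 0 ≤ K := by
    obtain ⟨a⟩ : Nonempty α := nonempty_of_isProbabilityMeasure μ
    exact (abs_nonneg _).trans (hb a)
  have hmem : MemLp X 2 μ := MemLp.of_bound hX.aestronglyMeasurable K (ae_of_all _ hb)
  have hint : Integrable X μ := hmem.integrable one_le_two
  have hvar : Var[X; μ] = ∫ a, X a ^ 2 ∂μ := by
    rw [variance_eq_integral hX, h0]; simp
  have hv0 : 0 ≤ Var[X; μ] := variance_nonneg _ _
  have hvK : Var[X; μ] ≤ K ^ 2 := by
    rw [hvar]
    calc ∫ a, X a ^ 2 ∂μ ≤ ∫ _, K ^ 2 ∂μ :=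
          integral_mono hmem.integrable_sq (integrable_const _) fun a => sq_le_sq'
            (abs_le.1 (hb a)).1 (abs_le.1 (hb a)).2
      _ = K ^ 2 := by simp
  -- The remainder bound `Complex.exp_bound` with `n = 3` has constant `4 / (3! * 3) = 2 / 9`.
  have hpt : ∀ a, ‖Complex.exp (X a * Complex.I) - (1 + X a * Complex.I - ((X a ^ 2 : ℝ) : ℂ) / 2)‖
      ≤ K ^ 3 * (2 / 9) := by
    intro a
    have hn : ‖(X a : ℂ) * Complex.I‖ = |X a| := by simp
    have h := Complex.exp_bound (x := X a * Complex.I) (by rw [hn]; exact (hb a).trans hK)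
      (n := 3) (by norm_num)
    have hs : ∑ m ∈ Finset.range 3, ((X a : ℂ) * Complex.I) ^ m / (m.factorial : ℂ) =
        1 + X a * Complex.I - ((X a ^ 2 : ℝ) : ℂ) / 2 := by
      simp [Finset.sum_range_succ, mul_pow]
      ring
    rw [hs, hn] at h
    refine h.trans ?_
    have : |X a| ^ 3 ≤ K ^ 3 := pow_le_pow_left₀ (abs_nonneg _) (hb a) 3
    norm_num [Nat.factorial]
    linarith
  have hI : Integrable (fun a => Complex.exp (X a * Complex.I)) μ :=
    Integrable.of_bound (by fun_prop) 1
      (ae_of_all _ fun a => (Complex.norm_exp_ofReal_mul_I _).le)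
  have hJ : Integrable (fun a => 1 + (X a : ℂ) * Complex.I - ((X a ^ 2 : ℝ) : ℂ) / 2) μ :=
    ((integrable_const _).add (hint.ofReal.mul_const _)).sub
      (hmem.integrable_sq.ofReal.div_const _)
  have hJv : ∫ a, (1 + (X a : ℂ) * Complex.I - ((X a ^ 2 : ℝ) : ℂ) / 2) ∂μ =
      1 - ((Var[X; μ] : ℝ) : ℂ) / 2 := by
    rw [integral_sub ((integrable_const _).add (hint.ofReal.mul_const _))
      (hmem.integrable_sq.ofReal.div_const _), integral_add (integrable_const _)
      (hint.ofReal.mul_const _), integral_mul_const, integral_div, integral_complex_ofReal,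
      integral_complex_ofReal, h0, hvar]
    simp
  have h1 : ‖∫ a, Complex.exp (X a * Complex.I) ∂μ - (1 - ((Var[X; μ] : ℝ) : ℂ) / 2)‖ ≤
      K ^ 3 * (2 / 9) := by
    rw [← hJv, ← integral_sub hI hJ]
    refine (norm_integral_le_of_norm_le_const (ae_of_all _ hpt)).trans ?_
    simp
  -- With `n = 2` the constant is `3 / (2! * 2) = 3 / 4`, and `(Var / 2)² ≤ K⁴ ≤ K³`. The two
  -- constants add up to `35 / 36`.
  have h2 : ‖(1 - ((Var[X; μ] : ℝ) : ℂ) / 2) - Complex.exp (-((Var[X; μ] : ℝ) : ℂ) / 2)‖ ≤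
      K ^ 3 * (3 / 4) := by
    have hn : ‖-((Var[X; μ] : ℝ) : ℂ) / 2‖ = Var[X; μ] / 2 := by
      rw [norm_div, norm_neg, Complex.norm_real, Real.norm_of_nonneg hv0]; simp
    have hK2 : K ^ 2 ≤ 1 := pow_le_one₀ hK0 hK
    have h := Complex.exp_bound (x := -((Var[X; μ] : ℝ) : ℂ) / 2)
      (by rw [hn]; linarith) (n := 2) (by norm_num)
    have hs : ∑ m ∈ Finset.range 2, (-((Var[X; μ] : ℝ) : ℂ) / 2) ^ m / (m.factorial : ℂ) =
        1 - ((Var[X; μ] : ℝ) : ℂ) / 2 := by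
      simp [Finset.sum_range_succ]
      ring
    rw [hs, hn] at h
    rw [norm_sub_rev]
    refine h.trans ?_
    have h4 : (Var[X; μ] / 2) ^ 2 ≤ K ^ 3 := by
      calc (Var[X; μ] / 2) ^ 2 ≤ (K ^ 2) ^ 2 := by gcongr; linarith
        _ = K ^ 3 * K := by ring
        _ ≤ K ^ 3 * 1 := by gcongr
        _ = K ^ 3 := mul_one _
    norm_num [Nat.factorial]
    linarith
  have h3 : 0 ≤ K ^ 3 := by positivity
  calc _ ≤ _ := norm_sub_le_norm_sub_add_norm_sub _ (1 - ((Var[X; μ] : ℝ) : ℂ) / 2) _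
    _ ≤ K ^ 3 * (2 / 9) + K ^ 3 * (3 / 4) := add_le_add h1 h2
    _ ≤ K ^ 3 := by linarith

/-- Factors are replaced one at a time; the remaining ones have modulus at most `1`. -/
lemma norm_prod_sub_prod_le_sum {ι : Type*} (s : Finset ι) (a b : ι → ℂ)
    (ha : ∀ i, ‖a i‖ ≤ 1) (hb : ∀ i, ‖b i‖ ≤ 1) :
    ‖∏ i ∈ s, a i - ∏ i ∈ s, b i‖ ≤ ∑ i ∈ s, ‖a i - b i‖ := by
  classical
  induction s using Finset.induction_on with
  | empty => simp
  | insert i s hi ih =>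
    rw [Finset.prod_insert hi, Finset.prod_insert hi, Finset.sum_insert hi]
    have hP : ‖∏ i ∈ s, b i‖ ≤ 1 := by
      rw [norm_prod]
      exact Finset.prod_le_one (fun _ _ => norm_nonneg _) fun j _ => hb j
    calc ‖a i * ∏ i ∈ s, a i - b i * ∏ i ∈ s, b i‖
        = ‖a i * (∏ i ∈ s, a i - ∏ i ∈ s, b i) + (a i - b i) * ∏ i ∈ s, b i‖ := by ring_nf
      _ ≤ ‖a i‖ * ‖∏ i ∈ s, a i - ∏ i ∈ s, b i‖ + ‖a i - b i‖ * ‖∏ i ∈ s, b i‖ := by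
          rw [← norm_mul, ← norm_mul]; exact norm_add_le _ _
      _ ≤ 1 * ‖∏ i ∈ s, a i - ∏ i ∈ s, b i‖ + ‖a i - b i‖ * 1 := by
          gcongr; exact ha i
      _ ≤ _ := by linarith

/-! ### The rotated diagonal form -/

/-- The matrix with eigenvalues `x`, `y` and eigenbasis the standard basis rotated by `α`. -/
noncomputable def rotDiag (α x y : ℝ) : Matrix (Fin 2) (Fin 2) ℝ :=
  !![x * Real.cos α ^ 2 + y * Real.sin α ^ 2, (x - y) * Real.sin α * Real.cos α;
     (x - y) * Real.sin α * Real.cos α, x * Real.sin α ^ 2 + y * Real.cos α ^ 2]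

lemma covFormula_eq_rotDiag (ν : Measure ℝ) (N : ℕ) (δ q p : ℝ) :
    covFormula ν N δ q p =
      rotDiag (2 * Real.pi * p / δ) (sigmaRSq ν N q p) (sigmaISq ν N q p) := rfl

lemma smul_rotDiag (a α x y : ℝ) : a • rotDiag α x y = rotDiag α (a * x) (a * y) := by
  ext i j
  fin_cases i <;> fin_cases j <;> simp [rotDiag] <;> ring

lemma dotProduct_rotDiag_mulVec (α x y : ℝ) (s : Fin 2 → ℝ) :
    s ⬝ᵥ rotDiag α x y *ᵥ s = x * (s 0 * Real.cos α + s 1 * Real.sin α) ^ 2 +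
      y * (s 0 * Real.sin α - s 1 * Real.cos α) ^ 2 := by
  simp [rotDiag, dotProduct, Matrix.mulVec, Fin.sum_univ_two]
  ring

lemma posSemidef_rotDiag (α : ℝ) {x y : ℝ} (hx : 0 ≤ x) (hy : 0 ≤ y) :
    (rotDiag α x y).PosSemidef := by
  refine Matrix.PosSemidef.of_dotProduct_mulVec_nonneg ?_ fun s => ?_
  · ext i j
    fin_cases i <;> fin_cases j <;> simp [rotDiag]
  · rw [star_trivial, dotProduct_rotDiag_mulVec]
    positivity

lemma det_rotDiag (α x y : ℝ) : (rotDiag α x y).det = x * y := by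
  have h := Real.sin_sq_add_cos_sq α
  rw [rotDiag, Matrix.det_fin_two_of]
  linear_combination (x * y * (Real.sin α ^ 2 + Real.cos α ^ 2 + 1)) * h

lemma sq_add_sq_rot (α : ℝ) (s : EuclideanSpace ℝ (Fin 2)) :
    (s 0 * Real.cos α + s 1 * Real.sin α) ^ 2 + (s 0 * Real.sin α - s 1 * Real.cos α) ^ 2 =
      ‖s‖ ^ 2 := by
  rw [EuclideanSpace.real_norm_sq_eq, Fin.sum_univ_two]
  linear_combination (s 0 ^ 2 + s 1 ^ 2) * Real.sin_sq_add_cos_sq α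

/-! ### Projections of the beampattern -/

/-- The component in the direction `s` of the steering term of the beampattern, without its
element-dependent factor. -/
noncomputable def direction (δ p : ℝ) (s : EuclideanSpace ℝ (Fin 2)) : ℂ :=
  (⟨s 0, -s 1⟩ : ℂ) * Complex.exp (((2 * Real.pi * (p / δ) : ℝ) : ℂ) * Complex.I)

/-- The coefficients of the random phases in the component of the beampattern in the
direction `s`. -/
noncomputable def coeff (N : ℕ) (δ q p : ℝ) (s : EuclideanSpace ℝ (Fin 2)) (n : ℕ) : ℂ :=
  (N : ℂ)⁻¹ * direction δ p s *
    Complex.exp (((2 * Real.pi * ((n : ℝ) - ((N : ℝ) - 1) / 2) * q : ℝ) : ℂ) * Complex.I)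

/-- With `direction_im`: these are the coordinates of `s` in the eigenbasis of the covariance, so
`‖direction‖²` and `Re (direction²)` are the sum and difference of the squares diagonalized by
`rotDiag`. -/
lemma direction_re (δ p : ℝ) (s : EuclideanSpace ℝ (Fin 2)) : (direction δ p s).re =
    s 0 * Real.cos (2 * Real.pi * p / δ) + s 1 * Real.sin (2 * Real.pi * p / δ) := by
  rw [direction, Complex.mul_re, Complex.exp_ofReal_mul_I_re, Complex.exp_ofReal_mul_I_im,
    ← mul_div_assoc]
  ring

lemma direction_im (δ p : ℝ) (s : EuclideanSpace ℝ (Fin 2)) : (direction δ p s).im =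
    s 0 * Real.sin (2 * Real.pi * p / δ) - s 1 * Real.cos (2 * Real.pi * p / δ) := by
  rw [direction, Complex.mul_im, Complex.exp_ofReal_mul_I_re, Complex.exp_ofReal_mul_I_im,
    ← mul_div_assoc]
  ring

lemma norm_direction (δ p : ℝ) (s : EuclideanSpace ℝ (Fin 2)) : ‖direction δ p s‖ = ‖s‖ := by
  rw [← sq_eq_sq₀ (norm_nonneg _) (norm_nonneg _), ← sq_add_sq_rot (2 * Real.pi * p / δ) s,
    ← Complex.normSq_eq_norm_sq, Complex.normSq_apply, direction_re, direction_im]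
  ring

lemma norm_coeff (N : ℕ) (δ q p : ℝ) (s : EuclideanSpace ℝ (Fin 2)) (n : ℕ) :
    ‖coeff N δ q p s n‖ = (N : ℝ)⁻¹ * ‖s‖ := by
  rw [coeff, norm_mul, Complex.norm_exp_ofReal_mul_I, norm_mul, norm_direction]
  simp

lemma sum_coeff_re (N : ℕ) (δ q p : ℝ) (s : EuclideanSpace ℝ (Fin 2)) :
    ∑ n ∈ Finset.range N, (coeff N δ q p s n).re =
      (N : ℝ)⁻¹ * sincRatio N q * (direction δ p s).re := by
  rw [← Complex.re_sum]
  simp only [coeff]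
  rw [← Finset.mul_sum, sum_exp_eq_sincRatio, Complex.re_mul_ofReal, ← Complex.ofReal_natCast,
    ← Complex.ofReal_inv, Complex.re_ofReal_mul]
  ring

lemma sum_coeff_sq_re (N : ℕ) (δ q p : ℝ) (s : EuclideanSpace ℝ (Fin 2)) :
    ∑ n ∈ Finset.range N, (coeff N δ q p s n ^ 2).re =
      ((N : ℝ)⁻¹) ^ 2 * sincRatio N (2 * q) * (direction δ p s ^ 2).re := by
  have h : ∀ n, coeff N δ q p s n ^ 2 = ((((N : ℝ)⁻¹) ^ 2 : ℝ) : ℂ) * direction δ p s ^ 2 *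
      Complex.exp (((2 * Real.pi * ((n : ℝ) - ((N : ℝ) - 1) / 2) * (2 * q) : ℝ) : ℂ) *
        Complex.I) := by
    intro n
    rw [coeff, mul_pow, mul_pow, ← Complex.exp_nat_mul]
    push_cast
    congr 2
    ring
  simp only [h]
  rw [← Complex.re_sum, ← Finset.mul_sum, sum_exp_eq_sincRatio, Complex.re_mul_ofReal,
    Complex.re_ofReal_mul]
  ring

/-- The scalar product of the plane is `Re ((s₀ - j s₁) β)`. -/
lemma inner_beamVector {Ω : Type*} (N : ℕ) (δ q p : ℝ) (m : ℕ → Ω → ℝ) (ω : Ω)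
    (s : EuclideanSpace ℝ (Fin 2)) :
    inner ℝ (beamVector N δ q p m ω) s =
      ∑ n ∈ Finset.range N, (coeff N δ q p s n * phase p (m n ω)).re := by
  have h : ∑ n ∈ Finset.range N, coeff N δ q p s n * phase p (m n ω) =
      (⟨s 0, -s 1⟩ : ℂ) * beampattern N δ q p (fun n => m n ω) := by
    rw [beampattern, Finset.mul_sum, Finset.mul_sum]
    refine Finset.sum_congr rfl fun n _ => ?_
    rw [coeff, direction, phase]
    ring
  rw [← Complex.re_sum, h, Complex.mul_re, PiLp.inner_apply, Fin.sum_univ_two]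
  simp [beamVector]

lemma inner_meanVector (ν : Measure ℝ) (N : ℕ) (δ q p : ℝ) (s : EuclideanSpace ℝ (Fin 2)) :
    inner ℝ (meanVector ν N δ q p) s =
      ∑ n ∈ Finset.range N, (coeff N δ q p s n).re * (genFun ν p).re := by
  rw [← Finset.sum_mul, sum_coeff_re, direction_re, meanVector, real_inner_smul_left,
    PiLp.inner_apply, Fin.sum_univ_two]
  simp
  ring

/-- In eigenbasis coordinates `u`, `v`, the modulus part contributes to `u² + v²` and the
`S_a^N(2q)` part to `u² - v²`; the coefficients of `u²` and `v²` are `σ_r²` and `σ_i²`. -/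
lemma sum_variance_coeff {N : ℕ} (hN : 0 < N) (ν : Measure ℝ) (δ q p : ℝ)
    (s : EuclideanSpace ℝ (Fin 2)) :
    ∑ n ∈ Finset.range N, (1 / 2 * ‖coeff N δ q p s n‖ ^ 2 * (1 - (genFun ν p).re ^ 2)
      - 1 / 2 * (coeff N δ q p s n ^ 2).re * ((genFun ν p).re ^ 2 - (genFun ν (2 * p)).re)) =
    s ⬝ᵥ covFormula ν N δ q p *ᵥ s := by
  have hN' : (N : ℝ) ≠ 0 := by positivity
  rw [covFormula_eq_rotDiag, dotProduct_rotDiag_mulVec, Finset.sum_sub_distrib, ← Finset.sum_mul,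
    ← Finset.sum_mul, ← Finset.mul_sum, ← Finset.mul_sum, sum_coeff_sq_re]
  simp only [norm_coeff, Finset.sum_const, Finset.card_range, nsmul_eq_mul]
  rw [mul_pow, ← sq_add_sq_rot (2 * Real.pi * p / δ) s, pow_two (direction δ p s), Complex.mul_re,
    direction_re, direction_im, sigmaRSq, sigmaISq]
  field_simp
  ring

lemma norm_beampattern_le (N : ℕ) (δ q p : ℝ) (m : ℕ → ℝ) : ‖beampattern N δ q p m‖ ≤ 1 := by
  rw [beampattern, norm_mul, norm_mul, Complex.norm_exp_ofReal_mul_I, mul_one]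
  have h : ‖∑ n ∈ Finset.range N,
      Complex.exp (((2 * Real.pi * ((n : ℝ) - ((N : ℝ) - 1) / 2) * q : ℝ) : ℂ) * Complex.I) *
        Complex.exp (((2 * Real.pi * m n * p : ℝ) : ℂ) * Complex.I)‖ ≤ N := by
    refine (norm_sum_le _ _).trans_eq ?_
    simp only [norm_mul, Complex.norm_exp_ofReal_mul_I]
    simp
  rw [norm_div, norm_one, Complex.norm_natCast, one_div, inv_mul_eq_div]
  exact div_le_one_of_le₀ h (Nat.cast_nonneg N)

lemma aemeasurable_beamVector {Ω : Type*} [MeasurableSpace Ω] {P : Measure Ω} {ν : Measure ℝ}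
    {m : ℕ → Ω → ℝ} (hm : ∀ n, HasLaw (m n) ν P) (N : ℕ) (δ q p : ℝ) :
    AEMeasurable (beamVector N δ q p m) P := by
  have hm' n := (hm n).aemeasurable
  have hb : AEMeasurable (fun ω => beampattern N δ q p fun n => m n ω) P := by
    unfold beampattern
    fun_prop
  unfold beamVector
  refine (PiLp.continuous_toLp 2 _).measurable.comp_aemeasurable
    (aemeasurable_pi_lambda _ fun i => ?_)
  fin_cases i
  · exact Complex.measurable_re.comp_aemeasurable hb
  · exact Complex.measurable_im.comp_aemeasurable hb

lemma aemeasurable_normalized {Ω : Type*} [MeasurableSpace Ω] {P : Measure Ω} {ν : Measure ℝ}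
    {m : ℕ → Ω → ℝ} (hm : ∀ n, HasLaw (m n) ν P) (N : ℕ) (δ q p : ℝ) :
    AEMeasurable
      (fun ω => Real.sqrt N • (beamVector N δ q p m ω - meanVector ν N δ q p)) P :=
  ((aemeasurable_beamVector hm N δ q p).sub_const _).const_smul (Real.sqrt N)

lemma memLp_beamVector {Ω : Type*} [MeasurableSpace Ω] {P : Measure Ω} [IsFiniteMeasure P]
    {ν : Measure ℝ} {m : ℕ → Ω → ℝ} (hm : ∀ n, HasLaw (m n) ν P) (N : ℕ) (δ q p : ℝ) :
    MemLp (beamVector N δ q p m) 2 P := by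
  refine MemLp.of_bound (aemeasurable_beamVector hm N δ q p).aestronglyMeasurable 1
    (ae_of_all _ fun ω => ?_)
  have h := norm_beampattern_le N δ q p fun n => m n ω
  refine le_of_eq_of_le ?_ h
  rw [← sq_eq_sq₀ (norm_nonneg _) (norm_nonneg _), EuclideanSpace.real_norm_sq_eq,
    ← Complex.normSq_eq_norm_sq, Complex.normSq_apply, Fin.sum_univ_two]
  simp [beamVector, pow_two]

/-! ### Exact mean and covariance -/

section Model

variable {Ω : Type*} [MeasurableSpace Ω] {P : Measure Ω} [IsProbabilityMeasure P]
  {ν : Measure ℝ} [IsProbabilityMeasure ν] {m : ℕ → Ω → ℝ}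

lemma integral_beamVector (hν : ν.map (fun x => -x) = ν) (hm : ∀ n, HasLaw (m n) ν P)
    (N : ℕ) (δ q p : ℝ) :
    ∫ ω, beamVector N δ q p m ω ∂P = meanVector ν N δ q p := by
  have hint := (memLp_beamVector hm N δ q p).integrable one_le_two
  have hm' n := (hm n).aemeasurable
  refine ext_inner_left ℝ fun s => ?_
  rw [← integral_inner hint s]
  simp_rw [real_inner_comm _ s]
  rw [inner_meanVector]
  simp_rw [inner_beamVector]
  rw [integral_finsetSum]
  · refine Finset.sum_congr rfl fun n _ => ?_
    rw [← integral_re_mul_phase hν]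
    exact (hm n).integral_comp (f := fun t => (coeff N δ q p s n * phase p t).re) (by fun_prop)
  · intro n _
    exact Integrable.of_bound (by fun_prop) _
      (ae_of_all _ fun ω => abs_re_mul_phase_le (coeff N δ q p s n) p (m n ω))

lemma variance_inner_beamVector (hν : ν.map (fun x => -x) = ν) (hm : ∀ n, HasLaw (m n) ν P)
    (hindep : iIndepFun m P) {N : ℕ} (hN : 0 < N) (δ q p : ℝ) (s : EuclideanSpace ℝ (Fin 2)) :
    Var[fun ω => inner ℝ (beamVector N δ q p m ω) s; P] = s ⬝ᵥ covFormula ν N δ q p *ᵥ s := by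
  have hm' n := (hm n).aemeasurable
  rw [← sum_variance_coeff hN]
  simp_rw [inner_beamVector]
  have h := IndepFun.variance_sum (μ := P) (s := Finset.range N)
    (X := fun n ω => (coeff N δ q p s n * phase p (m n ω)).re)
    (fun n _ => MemLp.of_bound (by fun_prop) _
      (ae_of_all _ fun ω => abs_re_mul_phase_le (coeff N δ q p s n) p (m n ω)))
    (fun i _ j _ hij => (hindep.indepFun hij).comp
      (φ := fun t => (coeff N δ q p s i * phase p t).re)
      (ψ := fun t => (coeff N δ q p s j * phase p t).re) (by fun_prop) (by fun_prop))
  have he : (∑ n ∈ Finset.range N, fun ω => (coeff N δ q p s n * phase p (m n ω)).re) =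
      fun ω => ∑ n ∈ Finset.range N, (coeff N δ q p s n * phase p (m n ω)).re := by
    ext ω; simp
  rw [← he, h]
  refine Finset.sum_congr rfl fun n _ => ?_
  rw [← variance_re_mul_phase hν]
  have hc : AEMeasurable (fun t => (coeff N δ q p s n * phase p t).re) ν := by fun_prop
  conv_rhs => rw [← (hm n).map_eq]
  rw [variance_map (by fun_prop) (hm' n)]
  rfl

/-- Polarization: the variances in the directions `(1, 0)`, `(0, 1)` and `(1, 1)` determine the
matrix. -/
lemma covMatrix_beamVector (hν : ν.map (fun x => -x) = ν) (hm : ∀ n, HasLaw (m n) ν P)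
    (hindep : iIndepFun m P) {N : ℕ} (hN : 0 < N) (δ q p : ℝ) :
    covMatrix P (beamVector N δ q p m) = covFormula ν N δ q p := by
  have hL : ∀ i, MemLp (fun ω => beamVector N δ q p m ω i) 2 P :=
    fun i => (memLp_beamVector hm N δ q p).eval_piLp i
  have hv := variance_inner_beamVector (P := P) hν hm hindep hN δ q p
  have h0 := hv !₂[1, 0]
  have h1 := hv !₂[0, 1]
  have h2 := hv !₂[1, 1]
  simp only [PiLp.inner_apply, Fin.sum_univ_two] at h0 h1 h2
  simp [dotProduct, Matrix.mulVec, Fin.sum_univ_two] at h0 h1 h2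
  rw [variance_fun_add (hL 0) (hL 1), h0, h1] at h2
  have hsym : covFormula ν N δ q p 1 0 = covFormula ν N δ q p 0 1 := rfl
  ext i j
  rw [covMatrix, Matrix.of_apply]
  fin_cases i <;> fin_cases j
  · simpa [covariance_self (hL 0).aemeasurable] using h0
  · simp only [Fin.mk_one, Fin.zero_eta]
    linarith
  · simp only [Fin.mk_one, Fin.zero_eta]
    rw [covariance_comm]
    linarith
  · simpa [covariance_self (hL 1).aemeasurable] using h1

/-- Both are variances of projections onto unit eigenvectors. They do not involve `δ`, so `δ = 1`
may be taken. -/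
lemma sigmaRSq_nonneg_and_sigmaISq_nonneg (hν : ν.map (fun x => -x) = ν)
    (hm : ∀ n, HasLaw (m n) ν P) (hindep : iIndepFun m P) {N : ℕ} (hN : 0 < N) (q p : ℝ) :
    0 ≤ sigmaRSq ν N q p ∧ 0 ≤ sigmaISq ν N q p := by
  have hv := variance_inner_beamVector (P := P) hν hm hindep hN 1 q p
  simp_rw [covFormula_eq_rotDiag, dotProduct_rotDiag_mulVec] at hv
  set α := 2 * Real.pi * p / 1
  have hα := Real.sin_sq_add_cos_sq α
  constructor
  · have h := hv !₂[Real.cos α, Real.sin α]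
    have h' := (variance_nonneg _ _).trans_eq h
    simp only [Matrix.cons_val_zero, Matrix.cons_val_one] at h'
    have e : sigmaRSq ν N q p * (Real.cos α * Real.cos α + Real.sin α * Real.sin α) ^ 2 +
        sigmaISq ν N q p * (Real.cos α * Real.sin α - Real.sin α * Real.cos α) ^ 2 =
        sigmaRSq ν N q p := by
      linear_combination (sigmaRSq ν N q p * (Real.sin α ^ 2 + Real.cos α ^ 2 + 1)) * hα
    exact e ▸ h'
  · have h := hv !₂[Real.sin α, -Real.cos α]
    have h' := (variance_nonneg _ _).trans_eq h
    simp only [Matrix.cons_val_zero, Matrix.cons_val_one] at h'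
    have e : sigmaRSq ν N q p * (Real.sin α * Real.cos α + -Real.cos α * Real.sin α) ^ 2 +
        sigmaISq ν N q p * (Real.sin α * Real.sin α - -Real.cos α * Real.cos α) ^ 2 =
        sigmaISq ν N q p := by
      linear_combination (sigmaISq ν N q p * (Real.sin α ^ 2 + Real.cos α ^ 2 + 1)) * hα
    exact e ▸ h'

end Model

/-! ### Characteristic function estimate -/

/-- Quantitative Gaussian approximation of the characteristic function of the standardized
beampattern. -/
lemma norm_charFun_sub_exp_le {Ω : Type*} [MeasurableSpace Ω] {P : Measure Ω}
    {ν : Measure ℝ} [IsProbabilityMeasure ν] {m : ℕ → Ω → ℝ}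
    (hν : ν.map (fun x => -x) = ν) (hm : ∀ n, HasLaw (m n) ν P)
    (hindep : iIndepFun m P) {N : ℕ} (hN : 0 < N) (δ q p : ℝ) (s : EuclideanSpace ℝ (Fin 2))
    (hs : 2 * ‖s‖ / Real.sqrt N ≤ 1) :
    ‖charFun (P.map fun ω => Real.sqrt N • (beamVector N δ q p m ω - meanVector ν N δ q p)) s -
      Complex.exp (-((s ⬝ᵥ ((N : ℝ) • covFormula ν N δ q p) *ᵥ s : ℝ) : ℂ) / 2)‖ ≤
      N * (2 * ‖s‖ / Real.sqrt N) ^ 3 := by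
  have hm' n := (hm n).aemeasurable
  have hsN : 0 < Real.sqrt N := Real.sqrt_pos.2 (by exact_mod_cast hN)
  have hsq : Real.sqrt N * Real.sqrt N = N := Real.mul_self_sqrt (Nat.cast_nonneg N)
  -- The centred contribution of element `n` to the projection on `s`; its bound is `√N` times twice
  -- `‖s‖ / N`.
  set ξ : ℕ → ℝ → ℝ := fun n t => Real.sqrt N * ((coeff N δ q p s n * phase p t).re
    - (coeff N δ q p s n).re * (genFun ν p).re) with hξ
  have hξm : ∀ n, Measurable (ξ n) := fun n => by fun_prop
  have hΦ : |(genFun ν p).re| ≤ 1 := by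
    refine (Complex.abs_re_le_norm _).trans ?_
    rw [← integral_phase]
    refine (norm_integral_le_of_norm_le_const (ae_of_all _ fun t => (norm_phase p t).le)).trans ?_
    simp
  have hbound : ∀ n t, |ξ n t| ≤ 2 * ‖s‖ / Real.sqrt N := by
    intro n t
    have h1 := abs_re_mul_phase_le (coeff N δ q p s n) p t
    have h2 : |(coeff N δ q p s n).re * (genFun ν p).re| ≤ ‖coeff N δ q p s n‖ := by
      rw [abs_mul]
      exact mul_le_of_le_one_right (abs_nonneg _) hΦ |>.trans (Complex.abs_re_le_norm _)
    rw [norm_coeff] at h1 h2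
    rw [hξ, abs_mul, abs_of_pos hsN, le_div_iff₀ hsN]
    have h3 := (abs_sub _ _).trans (add_le_add h1 h2)
    calc _ = (Real.sqrt N * Real.sqrt N) * |(coeff N δ q p s n * phase p t).re
            - (coeff N δ q p s n).re * (genFun ν p).re| := by ring
      _ ≤ N * ((N : ℝ)⁻¹ * ‖s‖ + (N : ℝ)⁻¹ * ‖s‖) := by rw [hsq]; gcongr
      _ = 2 * ‖s‖ := by
        have : (N : ℝ) ≠ 0 := by positivity
        field_simp; ring
  have hmean : ∀ n, ν[ξ n] = 0 := by
    intro n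
    rw [hξ, integral_const_mul, integral_sub
      ((memLp_re_mul_phase ν _ p).integrable one_le_two) (integrable_const _),
      integral_re_mul_phase hν]
    simp
  have hvar : ∑ n ∈ Finset.range N, Var[ξ n; ν] =
      s ⬝ᵥ ((N : ℝ) • covFormula ν N δ q p) *ᵥ s := by
    rw [Matrix.smul_mulVec, dotProduct_smul, smul_eq_mul, ← sum_variance_coeff hN,
      Finset.mul_sum]
    refine Finset.sum_congr rfl fun n _ => ?_
    rw [← variance_re_mul_phase hν, hξ, variance_const_mul, variance_sub_const (by fun_prop),
      pow_two, hsq]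
  have hfun : charFun (P.map fun ω =>
      Real.sqrt N • (beamVector N δ q p m ω - meanVector ν N δ q p)) s =
      ∏ n ∈ Finset.range N, ∫ t, Complex.exp (ξ n t * Complex.I) ∂ν := by
    rw [charFun_apply, integral_map (aemeasurable_normalized hm N δ q p) (by fun_prop)]
    have hpt : ∀ ω, Complex.exp (((inner ℝ
        (Real.sqrt N • (beamVector N δ q p m ω - meanVector ν N δ q p)) s : ℝ) : ℂ) * Complex.I) =
        ∏ n : Fin N, Complex.exp (ξ n (m n ω) * Complex.I) := by
      intro ω
      rw [real_inner_smul_left, inner_sub_left, inner_beamVector, inner_meanVector,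
        ← Finset.sum_sub_distrib, Finset.mul_sum, ← Complex.exp_sum, Finset.sum_range,
        ← Finset.sum_mul, Complex.ofReal_sum]
    simp_rw [hpt]
    rw [(hindep.precomp (Fin.val_injective (n := N))).integral_fun_prod_comp
      (X := fun n : Fin N => m n)
      (f := fun (n : Fin N) t => Complex.exp (ξ n t * Complex.I)) (fun n => hm' n)
      (fun n => by fun_prop), Finset.prod_range]
    refine Finset.prod_congr rfl fun n _ => ?_
    exact (hm n).integral_comp (f := fun t => Complex.exp (ξ n t * Complex.I)) (by fun_prop)
  have hexp : Complex.exp (-((s ⬝ᵥ ((N : ℝ) • covFormula ν N δ q p) *ᵥ s : ℝ) : ℂ) / 2) =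
      ∏ n ∈ Finset.range N, Complex.exp (-((Var[ξ n; ν] : ℝ) : ℂ) / 2) := by
    rw [← hvar, ← Complex.exp_sum, ← Finset.sum_div, Finset.sum_neg_distrib, Complex.ofReal_sum]
  rw [hfun, hexp]
  refine (norm_prod_sub_prod_le_sum _ _ _ (fun n => ?_) (fun n => ?_)).trans ?_
  · refine (norm_integral_le_of_norm_le_const
      (ae_of_all _ fun t => (Complex.norm_exp_ofReal_mul_I _).le)).trans ?_
    simp
  · rw [Complex.norm_exp, Real.exp_le_one_iff]
    have := variance_nonneg (ξ n) ν
    simp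
    linarith
  · refine (Finset.sum_le_sum fun n _ => norm_integral_exp_sub_exp_neg_variance_le
      (hξm n).aemeasurable hs (hbound n) (hmean n)).trans_eq ?_
    simp

/-! ### Eigenvalues of `N • M N` -/

lemma natCast_mul_sigmaRSq {N : ℕ} (hN : 0 < N) (ν : Measure ℝ) (q p : ℝ) :
    N * sigmaRSq ν N q p = 1 / 2 * (1 - (genFun ν p).re ^ 2
      - sincRatio N (2 * q) / N * ((genFun ν p).re ^ 2 - (genFun ν (2 * p)).re)) := by
  have : (N : ℝ) ≠ 0 := by positivity
  rw [sigmaRSq]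
  field_simp

lemma natCast_mul_sigmaISq {N : ℕ} (hN : 0 < N) (ν : Measure ℝ) (q p : ℝ) :
    N * sigmaISq ν N q p = 1 / 2 * (1 - (genFun ν p).re ^ 2
      + sincRatio N (2 * q) / N * ((genFun ν p).re ^ 2 - (genFun ν (2 * p)).re)) := by
  have : (N : ℝ) ≠ 0 := by positivity
  rw [sigmaISq]
  field_simp

lemma sincRatio_div_eq_one_or_neg_one {N : ℕ} (hN : 0 < N) {x : ℝ}
    (hx : Real.sin (Real.pi * x) = 0) : sincRatio N x / N = 1 ∨ sincRatio N x / N = -1 := by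
  have hN' : (N : ℝ) ≠ 0 := by positivity
  rw [sincRatio, if_pos hx, mul_div_cancel_left₀ _ hN']
  obtain ⟨k, hk⟩ := Real.sin_eq_zero_iff.1 hx
  have hs : Real.sin (((N : ℝ) - 1) * Real.pi * x) = 0 :=
    Real.sin_eq_zero_iff.2 ⟨((N : ℤ) - 1) * k, by push_cast; rw [mul_assoc, mul_assoc, hk]⟩
  exact Real.sin_eq_zero_iff_cos_eq.1 hs

lemma tendsto_sincRatio_div {x : ℝ} (hx : Real.sin (Real.pi * x) ≠ 0) :
    Tendsto (fun N : ℕ => sincRatio N x / N) atTop (𝓝 0) := by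
  have h : Tendsto (fun N : ℕ => |Real.sin (Real.pi * x)|⁻¹ * (N : ℝ)⁻¹) atTop (𝓝 0) := by
    simpa using tendsto_natCast_atTop_atTop.inv_tendsto_atTop.const_mul
      (|Real.sin (Real.pi * x)|⁻¹)
  refine squeeze_zero_norm (fun N => ?_) h
  rw [sincRatio, if_neg hx, norm_div, norm_div, Real.norm_natCast, Real.norm_eq_abs,
    Real.norm_eq_abs, div_eq_mul_inv, div_eq_mul_inv]
  gcongr
  exact mul_le_of_le_one_left (by positivity) (Real.abs_sin_le_one _)

/-- If the covariance matrices are eventually nondegenerate, the eigenvalues of `N • M N` are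
eventually bounded away from zero. -/
lemma exists_pos_eventually_le_eigenvalues {ν : Measure ℝ} {q p : ℝ}
    (h : ∀ᶠ N : ℕ in atTop, 0 < sigmaRSq ν N q p ∧ 0 < sigmaISq ν N q p) :
    ∃ c > 0, ∀ᶠ N : ℕ in atTop, c ≤ N * sigmaRSq ν N q p ∧ c ≤ N * sigmaISq ν N q p := by
  set a := 1 - (genFun ν p).re ^ 2 with ha
  set b := (genFun ν p).re ^ 2 - (genFun ν (2 * p)).re with hb
  obtain ⟨N₀, ⟨hr, hi⟩, hN₀⟩ := (h.and (eventually_gt_atTop 0)).exists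
  have hN₀' : (0 : ℝ) < N₀ := by exact_mod_cast hN₀
  have hr' := mul_pos hN₀' hr
  have hi' := mul_pos hN₀' hi
  rw [natCast_mul_sigmaRSq hN₀, ← ha, ← hb] at hr'
  rw [natCast_mul_sigmaISq hN₀, ← ha, ← hb] at hi'
  by_cases hx : Real.sin (Real.pi * (2 * q)) = 0
  -- The ratio is `±1`, and its sign only exchanges `a - b` and `a + b`; one nondegenerate `N₀`
  -- therefore bounds the eigenvalues for all `N > 0`.
  · have hab : 0 < a - b ∧ 0 < a + b := by
      rcases sincRatio_div_eq_one_or_neg_one hN₀ hx with e | e <;> rw [e] at hr' hi' <;>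
        constructor <;> linarith
    refine ⟨1 / 2 * min (a - b) (a + b), mul_pos (by norm_num) (lt_min hab.1 hab.2), ?_⟩
    filter_upwards [eventually_gt_atTop 0] with N hN
    rw [natCast_mul_sigmaRSq hN, natCast_mul_sigmaISq hN, ← ha, ← hb]
    have h1 := min_le_left (a - b) (a + b)
    have h2 := min_le_right (a - b) (a + b)
    rcases sincRatio_div_eq_one_or_neg_one hN hx with e | e <;> rw [e] <;>
      constructor <;> linarith
  -- The eigenvalues at `N₀` sum to `a`. Since the ratio tends to `0`, both eigenvalues tend to `a /
  -- 2`, leaving room for `a / 4`.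
  · have hapos : 0 < a := by linarith
    have hlim : Tendsto (fun N : ℕ => sincRatio N (2 * q) / N * b) atTop (𝓝 0) := by
      simpa using (tendsto_sincRatio_div hx).mul_const b
    refine ⟨a / 4, by linarith, ?_⟩
    filter_upwards [eventually_gt_atTop 0, hlim.eventually_lt_const (u := a / 2) (by linarith),
      hlim.eventually_const_lt (u := -(a / 2)) (by linarith)] with N hN h1 h2
    rw [natCast_mul_sigmaRSq hN, natCast_mul_sigmaISq hN, ← ha, ← hb]
    constructor <;> linarith

/-- The characteristic function of the standardized beampattern is asymptotic to that of the
Gaussian law with the same covariance, uniformly on bounded sets. -/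
lemma tendsto_charFun_sub_exp {Ω : Type*} [MeasurableSpace Ω] {P : Measure Ω}
    {ν : Measure ℝ} [IsProbabilityMeasure ν] {m : ℕ → Ω → ℝ}
    (hν : ν.map (fun x => -x) = ν) (hm : ∀ n, HasLaw (m n) ν P)
    (hindep : iIndepFun m P) (δ q p : ℝ) {s : ℕ → EuclideanSpace ℝ (Fin 2)} {C : ℝ}
    (hs : ∀ᶠ N in atTop, ‖s N‖ ≤ C) :
    Tendsto (fun N : ℕ =>
      charFun (P.map fun ω => Real.sqrt N • (beamVector N δ q p m ω - meanVector ν N δ q p)) (s N) -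
      Complex.exp (-((s N ⬝ᵥ ((N : ℝ) • covFormula ν N δ q p) *ᵥ s N : ℝ) : ℂ) / 2))
      atTop (𝓝 0) := by
  have hinv : Tendsto (fun N : ℕ => (Real.sqrt N)⁻¹) atTop (𝓝 0) :=
    (Real.tendsto_sqrt_atTop.comp tendsto_natCast_atTop_atTop).inv_tendsto_atTop
  have hsmall : Tendsto (fun N : ℕ => 2 * C * (Real.sqrt N)⁻¹) atTop (𝓝 0) := by
    simpa using hinv.const_mul (2 * C)
  have hlim : Tendsto (fun N : ℕ => (2 * C) ^ 3 * (Real.sqrt N)⁻¹) atTop (𝓝 0) := by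
    simpa using hinv.const_mul ((2 * C) ^ 3)
  refine squeeze_zero_norm' ?_ hlim
  filter_upwards [hs, eventually_gt_atTop 0, hsmall.eventually_le_const one_pos]
    with N hsN hN hle
  have hbound : 2 * ‖s N‖ / Real.sqrt N ≤ 2 * C * (Real.sqrt N)⁻¹ := by
    rw [div_eq_mul_inv]; gcongr
  refine (norm_charFun_sub_exp_le hν hm hindep hN δ q p (s N) (hbound.trans hle)).trans ?_
  have hpos : 0 < Real.sqrt N := Real.sqrt_pos.2 (by exact_mod_cast hN)
  calc N * (2 * ‖s N‖ / Real.sqrt N) ^ 3 ≤ N * (2 * C * (Real.sqrt N)⁻¹) ^ 3 := by gcongr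
    _ = (Real.sqrt N * Real.sqrt N) * (2 * C * (Real.sqrt N)⁻¹) ^ 3 := by
      rw [Real.mul_self_sqrt (Nat.cast_nonneg N)]
    _ = (2 * C) ^ 3 * (Real.sqrt N)⁻¹ := by field_simp

/-! ### The two Gaussian limits -/

section Limit

variable {Ω : Type*} [MeasurableSpace Ω] {P : Measure Ω} [IsProbabilityMeasure P]
  {ν : Measure ℝ} [IsProbabilityMeasure ν] {m : ℕ → Ω → ℝ}

/-- For `N > 0` the two nonnegative numbers sum to `1 - Φ(p)²`, which bounds each; this supplies the
compactness. -/
lemma natCast_mul_sigma_mem_Icc (hν : ν.map (fun x => -x) = ν) (hm : ∀ n, HasLaw (m n) ν P)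
    (hindep : iIndepFun m P) (N : ℕ) (q p : ℝ) :
    ((N * sigmaRSq ν N q p, N * sigmaISq ν N q p) : ℝ × ℝ) ∈
      Set.Icc 0 (1 - (genFun ν p).re ^ 2, 1 - (genFun ν p).re ^ 2) := by
  have key : ∀ N : ℕ, 0 < N →
      ((N * sigmaRSq ν N q p, N * sigmaISq ν N q p) : ℝ × ℝ) ∈
        Set.Icc 0 (1 - (genFun ν p).re ^ 2, 1 - (genFun ν p).re ^ 2) := by
    intro N hN
    obtain ⟨hr, hi⟩ := sigmaRSq_nonneg_and_sigmaISq_nonneg hν hm hindep hN q p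
    have hr' := mul_nonneg (Nat.cast_nonneg (α := ℝ) N) hr
    have hi' := mul_nonneg (Nat.cast_nonneg (α := ℝ) N) hi
    refine ⟨⟨hr', hi'⟩, ?_⟩
    rw [natCast_mul_sigmaRSq hN, natCast_mul_sigmaISq hN] at *
    constructor <;> simp only <;> linarith
  -- At `N = 0` the pair is the origin, and the case `N = 1` shows that the interval is nonempty.
  rcases N.eq_zero_or_pos with rfl | hN
  · have h := key 1 one_pos
    simp only [Nat.cast_zero, zero_mul]
    exact ⟨le_rfl, h.1.trans h.2⟩
  · exact key N hN

lemma tendsto_integral_sub_gaussian (hν : ν.map (fun x => -x) = ν)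
    (hm : ∀ n, HasLaw (m n) ν P) (hindep : iIndepFun m P) (δ q p : ℝ)
    (f : EuclideanSpace ℝ (Fin 2) →ᵇ ℝ) :
    Tendsto (fun N : ℕ =>
      (∫ ω, f (Real.sqrt N • (beamVector N δ q p m ω - meanVector ν N δ q p)) ∂P)
        - ∫ x, f x ∂(multivariateGaussian 0 ((N : ℝ) • covFormula ν N δ q p))) atTop (𝓝 0) := by
  refine tendsto_of_subseq_tendsto fun ns hns => ?_
  set α := 2 * Real.pi * p / δ with hα
  set z : ℕ → ℝ × ℝ := fun N => (N * sigmaRSq ν N q p, N * sigmaISq ν N q p) with hz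
  have hzmem : ∀ N, z N ∈ _ := fun N => natCast_mul_sigma_mem_Icc hν hm hindep N q p
  have hcov : ∀ N : ℕ, (N : ℝ) • covFormula ν N δ q p = rotDiag α (z N).1 (z N).2 := fun N => by
    rw [covFormula_eq_rotDiag, smul_rotDiag]
  obtain ⟨w, hw, φ, hφ, hlim⟩ := isCompact_Icc.tendsto_subseq fun k => hzmem (ns k)
  refine ⟨φ, ?_⟩
  have hnsφ : Tendsto (fun k => ns (φ k)) atTop atTop := hns.comp hφ.tendsto_atTop
  have hpsd : ∀ N, (rotDiag α (z N).1 (z N).2).PosSemidef := fun N =>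
    posSemidef_rotDiag α (hzmem N).1.1 (hzmem N).1.2
  have hpsdw : (rotDiag α w.1 w.2).PosSemidef := posSemidef_rotDiag α hw.1.1 hw.1.2
  have hexp : ∀ s : EuclideanSpace ℝ (Fin 2), Tendsto (fun k => Complex.exp
      (-((s ⬝ᵥ rotDiag α (z (ns (φ k))).1 (z (ns (φ k))).2 *ᵥ s : ℝ) : ℂ) / 2)) atTop
      (𝓝 (Complex.exp (-((s ⬝ᵥ rotDiag α w.1 w.2 *ᵥ s : ℝ) : ℂ) / 2))) := by
    intro s
    have hc : Continuous fun z : ℝ × ℝ =>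
        Complex.exp (-((s ⬝ᵥ rotDiag α z.1 z.2 *ᵥ s : ℝ) : ℂ) / 2) := by
      simp_rw [dotProduct_rotDiag_mulVec]
      fun_prop
    exact (hc.tendsto w).comp hlim
  have hgauss : ∀ {S : Matrix (Fin 2) (Fin 2) ℝ}, S.PosSemidef → ∀ s : EuclideanSpace ℝ (Fin 2),
      charFun (multivariateGaussian 0 S) s = Complex.exp (-((s ⬝ᵥ S *ᵥ s : ℝ) : ℂ) / 2) := by
    intro S hS s
    rw [charFun_multivariateGaussian hS]
    simp only [inner_zero_right, Complex.ofReal_zero, zero_mul, zero_sub, neg_div]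
  let G : ProbabilityMeasure (EuclideanSpace ℝ (Fin 2)) :=
    ⟨multivariateGaussian 0 (rotDiag α w.1 w.2), inferInstance⟩
  let L : ℕ → ProbabilityMeasure (EuclideanSpace ℝ (Fin 2)) := fun N =>
    ⟨P.map fun ω => Real.sqrt N • (beamVector N δ q p m ω - meanVector ν N δ q p),
      Measure.isProbabilityMeasure_map (aemeasurable_normalized hm N δ q p)⟩
  let H : ℕ → ProbabilityMeasure (EuclideanSpace ℝ (Fin 2)) := fun N =>
    ⟨multivariateGaussian 0 (rotDiag α (z N).1 (z N).2), inferInstance⟩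
  have hL : Tendsto (fun k => L (ns (φ k))) atTop (𝓝 G) := by
    refine ProbabilityMeasure.tendsto_of_tendsto_charFun fun s => ?_
    have h := ((tendsto_charFun_sub_exp hν hm hindep δ q p (s := fun _ => s)
      (Eventually.of_forall fun _ => le_rfl)).comp hnsφ).add (hexp s)
    simp only [Function.comp_def, hcov, sub_add_cancel, zero_add] at h
    simpa only [L, G, ProbabilityMeasure.coe_mk, hgauss hpsdw] using h
  have hH : Tendsto (fun k => H (ns (φ k))) atTop (𝓝 G) := by
    refine ProbabilityMeasure.tendsto_of_tendsto_charFun fun s => ?_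
    simpa only [H, G, ProbabilityMeasure.coe_mk, hgauss hpsdw, hgauss (hpsd _)] using hexp s
  rw [ProbabilityMeasure.tendsto_iff_forall_integral_tendsto] at hL hH
  have h := (hL f).sub (hH f)
  rw [sub_self] at h
  refine h.congr fun k => ?_
  simp only [L, H, ProbabilityMeasure.coe_mk, hcov]
  rw [integral_map (aemeasurable_normalized hm _ δ q p)
    f.continuous.measurable.aestronglyMeasurable]

lemma inner_toEuclideanLin_left (A : Matrix (Fin 2) (Fin 2) ℝ) (x t : EuclideanSpace ℝ (Fin 2)) :
    inner ℝ (Matrix.toEuclideanLin A x) t = inner ℝ x (Matrix.toEuclideanLin Aᵀ t) := by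
  rw [← Matrix.conjTranspose_eq_transpose_of_trivial,
    Matrix.toEuclideanLin_conjTranspose_eq_adjoint, LinearMap.adjoint_inner_right]

lemma tendstoInDistribution_standardized (hν : ν.map (fun x => -x) = ν)
    (hm : ∀ n, HasLaw (m n) ν P) (hindep : iIndepFun m P) (δ q p : ℝ)
    (A : ℕ → Matrix (Fin 2) (Fin 2) ℝ)
    (hA : ∀ᶠ N in atTop, A N * covFormula ν N δ q p * (A N).transpose = 1) :
    TendstoInDistribution
      (fun N ω => Matrix.toEuclideanLin (A N) (beamVector N δ q p m ω - meanVector ν N δ q p))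
      atTop id (fun _ => P) (stdGaussian (EuclideanSpace ℝ (Fin 2))) := by
  have hmeas : ∀ N, AEMeasurable (fun ω =>
      Matrix.toEuclideanLin (A N) (beamVector N δ q p m ω - meanVector ν N δ q p)) P := fun N =>
    (LinearMap.continuous_of_finiteDimensional _).measurable.comp_aemeasurable
      ((aemeasurable_beamVector hm N δ q p).sub_const _)
  -- Determinants in `A M Aᵀ = 1` exclude a zero eigenvalue.
  have hpos : ∀ᶠ N : ℕ in atTop, 0 < sigmaRSq ν N q p ∧ 0 < sigmaISq ν N q p := by
    filter_upwards [hA, eventually_gt_atTop 0] with N hAN hN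
    obtain ⟨hr, hi⟩ := sigmaRSq_nonneg_and_sigmaISq_nonneg hν hm hindep hN q p
    have hdet := congrArg Matrix.det hAN
    rw [Matrix.det_mul, Matrix.det_mul, covFormula_eq_rotDiag, det_rotDiag, Matrix.det_one] at hdet
    exact ⟨hr.lt_of_ne' fun h => by simp [h] at hdet, hi.lt_of_ne' fun h => by simp [h] at hdet⟩
  obtain ⟨c, hc, hle⟩ := exists_pos_eventually_le_eigenvalues hpos
  refine ⟨hmeas, aemeasurable_id, ProbabilityMeasure.tendsto_of_tendsto_charFun fun t => ?_⟩
  simp only [ProbabilityMeasure.coe_mk, Measure.map_id, charFun_stdGaussian]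
  -- Chosen so that pairing `√N (β_N - μ_N)` with `s N` equals pairing `A_N (β_N - μ_N)` with `t`.
  set s : ℕ → EuclideanSpace ℝ (Fin 2) := fun N =>
    (Real.sqrt N)⁻¹ • Matrix.toEuclideanLin (A N)ᵀ t with hs
  have hquad : ∀ᶠ N : ℕ in atTop,
      s N ⬝ᵥ ((N : ℝ) • covFormula ν N δ q p) *ᵥ s N = ‖t‖ ^ 2 := by
    filter_upwards [hA, eventually_gt_atTop 0] with N hAN hN
    have hN' : (N : ℝ) ≠ 0 := by positivity
    have hsq : (Real.sqrt N)⁻¹ * (Real.sqrt N)⁻¹ = (N : ℝ)⁻¹ := by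
      rw [← mul_inv, Real.mul_self_sqrt (Nat.cast_nonneg N)]
    have e : (s N).ofLp = (Real.sqrt N)⁻¹ • ((A N)ᵀ *ᵥ t.ofLp) := rfl
    rw [e, Matrix.smul_mulVec, Matrix.mulVec_smul, smul_dotProduct, dotProduct_smul,
      dotProduct_smul, smul_eq_mul, smul_eq_mul, smul_eq_mul, Matrix.mulVec_transpose,
      ← Matrix.dotProduct_mulVec, ← Matrix.mulVec_transpose, Matrix.mulVec_mulVec,
      Matrix.mulVec_mulVec, ← mul_assoc, hAN, Matrix.one_mulVec, EuclideanSpace.real_norm_sq_eq]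
    rw [mul_left_comm, ← mul_assoc, ← mul_assoc (Real.sqrt N)⁻¹, hsq, inv_mul_cancel₀ hN', one_mul]
    simp [dotProduct, pow_two]
  -- The lower eigenvalue bound gives `c ‖s N‖² ≤ ‖t‖²`.
  have hbound : ∀ᶠ N in atTop, ‖s N‖ ≤ Real.sqrt (‖t‖ ^ 2 / c) := by
    filter_upwards [hquad, hle] with N hq hcN
    refine Real.le_sqrt_of_sq_le ?_
    rw [le_div_iff₀ hc, ← hq, covFormula_eq_rotDiag, smul_rotDiag, dotProduct_rotDiag_mulVec,
      ← sq_add_sq_rot (2 * Real.pi * p / δ), add_mul, mul_comm _ c, mul_comm _ c]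
    exact add_le_add (mul_le_mul_of_nonneg_right hcN.1 (sq_nonneg _))
      (mul_le_mul_of_nonneg_right hcN.2 (sq_nonneg _))
  have h := (tendsto_charFun_sub_exp hν hm hindep δ q p hbound).add_const
    (Complex.exp (-(‖t‖ : ℂ) ^ 2 / 2))
  rw [zero_add] at h
  refine h.congr' ?_
  filter_upwards [hquad, eventually_gt_atTop 0] with N hq hN
  have hsN : Real.sqrt N ≠ 0 := (Real.sqrt_pos.2 (by exact_mod_cast hN)).ne'
  rw [hq, Complex.ofReal_pow, sub_add_cancel, charFun_apply, charFun_apply,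
    integral_map (aemeasurable_normalized hm N δ q p) (by fun_prop),
    integral_map (hmeas N) (by fun_prop)]
  congr with ω
  rw [inner_toEuclideanLin_left, hs, real_inner_smul_left, real_inner_smul_right, ← mul_assoc,
    mul_inv_cancel₀ hsN, one_mul]

end Limit

end RFDA

theorem theorem1 {Ω : Type*} [MeasurableSpace Ω] (P : Measure Ω) [IsProbabilityMeasure P]
    (ν : Measure ℝ) [IsProbabilityMeasure ν] (hν : ν.map (fun x => -x) = ν)
    (m : ℕ → Ω → ℝ) (hm : ∀ n, HasLaw (m n) ν P) (hindep : iIndepFun m P)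
    (δ q p : ℝ) (hδ : δ ≠ 0) :
    (∀ x : ℝ, (((RFDA.genFun ν x).re : ℝ) : ℂ) = RFDA.genFun ν x) ∧
    (∀ N : ℕ, 0 < N →
      MemLp (RFDA.beamVector N δ q p m) 2 P ∧
      ∫ ω, RFDA.beamVector N δ q p m ω ∂P = RFDA.meanVector ν N δ q p ∧
      RFDA.covMatrix P (RFDA.beamVector N δ q p m) = RFDA.covFormula ν N δ q p) ∧
    RFDA.AsymptoticallyGaussian P (fun N => RFDA.beamVector N δ q p m)
      (fun N => RFDA.meanVector ν N δ q p) (fun N => RFDA.covFormula ν N δ q p) :=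
  ⟨RFDA.genFun_eq_re hν,
    fun N hN => ⟨RFDA.memLp_beamVector hm N δ q p, RFDA.integral_beamVector hν hm N δ q p,
      RFDA.covMatrix_beamVector hν hm hindep hN δ q p⟩,
    ⟨RFDA.tendsto_integral_sub_gaussian hν hm hindep δ q p,
      RFDA.tendstoInDistribution_standardized hν hm hindep δ q p⟩⟩
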